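/- **Notation.** A Young diagram of degree $n\ge 0$ is a multiset $\Delta$ of positive integers (its line lengths) with sum $|\Delta|=n$; put $|\mathrm{Aut}(\Delta)|=\prod_j m_j!\,j^{m_j}$, where $m_j$ is the number of lines of length $j$. Let $A_n$ be the complex vector space with basis the Young diagrams of degree $n$. For Young diagrams $\Delta_1,\dots,\Delta_k$ of degree $n$ let $H(\Delta_1,\dots,\Delta_k)$ be the Hurwitz number of the sphere: the sum of $1/|\mathrm{Aut}|$ over the isomorphism classes of (not necessarily connected) degree $n$ coverings of the sphere, with critical values contained in $k$ marked points and of topological types $\Delta_1,\dots,\Delta_k$ there. Here a covering is given by its monodromy, i.e. by permutations $s_1,\dots,s_k\in S_n$ of cycle types $\Delta_1,\dots,\Delta_k$ with $s_1\cdots s_k=1$; isomorphisms are simultaneous conjugations, and $\mathrm{Aut}$ is the common centralizer. The product $*$ on $A_n$ is the bilinear operation $$\Delta_1*\Delta_2=\sum_{|\Delta_3|=n}|\mathrm{Aut}(\Delta_3)|\,H(\Delta_1,\Delta_2,\Delta_3)\,\Delta_3 ,$$ that is, $(\Delta_1*\Delta_2,\Delta_3)=H(\Delta_1,\Delta_2,\Delta_3)$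 for the form $(\Delta,\Delta')=H(\Delta,\Delta')=\delta_{\Delta,\Delta'}/|\mathrm{Aut}(\Delta)|$. It makes $A_n$ a commutative algebra with unit the diagram $1^n$ all of whose lines have length $1$. Let $A^{as}=\prod_{n\ge1}A_n$ be the algebra of sequences $(a^1,a^2,\dots)$, $a^n\in A_n$, with entrywise operations. For $m\le n$ let $\rho^A_n:A_m\to A_n$ be the linear map $$\rho^A_n(\Delta)=\frac{|\mathrm{Aut}(\tilde\Delta)|}{|\mathrm{Aut}(\Delta)|\,|\mathrm{Aut}(\tilde\Delta\setminus\Delta)|}\,\tilde\Delta ,$$ where $\tilde\Delta$ is $\Delta$ with $n-m$ lines of length $1$ added and $\tilde\Delta\setminus\Delta=1^{n-m}$. For $a\in A_m$ let $a^{as}=(a^1,a^2,\dots)\in A^{as}$, where $a^i=0$ for $i<m$ and $a^i=\rho^A_i(a)$ for $i\ge m$. Let $D_\infty$ be the semigroup of pairs $(d,\sigma)$, where $d$ is a finite set of natural numbers and $\sigma$ is a permutation of $d$, with $(d_1,\sigma_1)(d_2,\sigma_2)=(d_1\cup d_2,\sigma_1\sigma_2)$, permutations being extended by the identity. Every element of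 $D_\infty$ has finitely many factorizations into two elements, so formal, possibly infinite, complex linear combinations of elements of $D_\infty$ form an algebra. For a Young diagram $\Delta$ let $[\Delta]=\sum(d,\sigma)$ be the formal sum over all $(d,\sigma)$ such that $\sigma$ has cycle type $\Delta$ on $d$ (fixed points in $d$ included). The Ivanov–Kerov algebra $A_\infty$ is the linear span of all $[\Delta]$, $|\Delta|\ge0$, which is a subalgebra; its unit is $[\emptyset]$. Identify $\Delta$ with $[\Delta]$, so that each $A_m$ maps linearly to $A_\infty$. **Theorem 3.1.** The correspondence $a\mapsto a^{as}$ ($a\in A_m$, $m\ge0$) extends linearly, in a unique way, to a map $\rho^A_\uparrow:A_\infty\to A^{as}$, and $\rho^A_\uparrow$ is an injective homomorphism of unital $\mathbb{C}$-algebras. (In particular its restriction to the span of the $[\Delta]$ with $|\Delta|\ge1$ is an injective algebra homomorphism.) -/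

import Mathlib

open scoped Nat

noncomputable section

/-- The order of the automorphism group of a Young diagram whose lines have the lengths listed
in `m`: `∏ j, m_j! * j ^ m_j`, where `m_j` is the number of lines of length `j`. -/
def autCard (m : Multiset ℕ) : ℕ := ∏ j ∈ m.toFinset, (m.count j)! * j ^ m.count j

/-- The cycle type of a permutation of `n` points (fixed points included), as a Young diagram of
degree `n`. -/
def permType {n : ℕ} (s : Equiv.Perm (Fin n)) : n.Partition where
  parts := s.partition.parts
  parts_pos := s.partition.parts_pos
  parts_sum := by simpa using s.partition.parts_sum

theorem permType_eq_iff {n : ℕ} (s t : Equiv.Perm (Fin n)) :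
    permType s = permType t ↔ IsConj s t := by
  rw [Equiv.Perm.partition_eq_of_isConj, Nat.Partition.ext_iff, Nat.Partition.ext_iff]
  rfl

theorem permType_conj {n : ℕ} (g s : Equiv.Perm (Fin n)) :
    permType (g * s * g⁻¹) = permType s :=
  (permType_eq_iff _ _).2 (isConj_iff.2 ⟨g⁻¹, by group⟩)

theorem permType_inv {n : ℕ} (s : Equiv.Perm (Fin n)) : permType s⁻¹ = permType s := by
  rw [permType_eq_iff, Equiv.Perm.isConj_iff_cycleType_eq, Equiv.Perm.cycleType_inv]

theorem permType_surjective (n : ℕ) : Function.Surjective (permType (n := n)) := by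
  intro p
  have key : (p.parts.filter fun i => 2 ≤ i) +
      Multiset.replicate (n - (p.parts.filter fun i => 2 ≤ i).sum) 1 = p.parts := by
    have h1 : p.parts.filter (fun i => ¬ 2 ≤ i) =
        Multiset.replicate (p.parts.filter fun i => ¬ 2 ≤ i).card 1 := by
      rw [Multiset.eq_replicate_card]
      intro b hb
      have := p.parts_pos (Multiset.mem_of_mem_filter hb)
      have := Multiset.of_mem_filter hb
      omega
    have h2 := Multiset.filter_add_not (fun i => 2 ≤ i) p.parts
    have h3 : (p.parts.filter fun i => ¬ 2 ≤ i).sum =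
        (p.parts.filter fun i => ¬ 2 ≤ i).card := by
      conv_lhs => rw [h1]
      simp
    have h4 := congrArg Multiset.sum h2
    rw [Multiset.sum_add, p.parts_sum, h3] at h4
    conv_rhs => rw [← h2, h1]
    congr 2
    omega
  obtain ⟨s, hs⟩ := (Equiv.Perm.exists_with_cycleType_iff (Fin n)
      (m := p.parts.filter fun i => 2 ≤ i)).2 ⟨by
        have h2 := congrArg Multiset.sum (Multiset.filter_add_not (fun i => 2 ≤ i) p.parts)
        rw [Multiset.sum_add, p.parts_sum] at h2
        simp only [Fintype.card_fin]
        omega, fun a ha => Multiset.of_mem_filter ha⟩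
  refine ⟨s, Nat.Partition.ext ?_⟩
  change s.partition.parts = _
  rw [Equiv.Perm.parts_partition, ← Equiv.Perm.sum_cycleType, hs, Fintype.card_fin, key]

/-- A covering of the sphere of degree `n` (not necessarily connected) with critical values among
`k` marked points, given by its monodromy: the fibre over a base point is numbered by `Fin n`,
going around the `i`-th marked point permutes the fibre by `s i`, and `s 0 * ⋯ * s (k - 1) = 1`.
The local invariant at the `i`-th marked point (the degrees of the contours over a small circle
around it) is the cycle type of `s i`; it is prescribed to be `α i`.
Isomorphisms of coverings are simultaneous conjugations, so the acting group is the symmetric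
group acting by conjugation. -/
def sphereCoverings {n k : ℕ} (α : Fin k → n.Partition) :
    SubMulAction (ConjAct (Equiv.Perm (Fin n))) (Fin k → Equiv.Perm (Fin n)) where
  carrier := {s | (∀ i, permType (s i) = α i) ∧ (List.ofFn s).prod = 1}
  smul_mem' := by
    rintro g s ⟨h1, h2⟩
    refine ⟨fun i => ?_, ?_⟩
    · rw [Pi.smul_apply, ConjAct.smul_def, permType_conj, h1]
    · have : List.ofFn (g • s) = (List.ofFn s).map (MulDistribMulAction.toMonoidHom _ g) := by
        rw [List.map_ofFn]; rfl
      rw [this, ← map_list_prod, h2, map_one]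

/-- The Hurwitz number of degree `n` of the sphere with `k` marked points: the sum over the
isomorphism classes of coverings with local invariants `α` of `1 / |Aut|`. -/
def hurwitzNumber {n k : ℕ} (α : Fin k → n.Partition) : ℚ :=
  ∑ᶠ c : MulAction.orbitRel.Quotient (ConjAct (Equiv.Perm (Fin n))) (sphereCoverings α),
    1 / (Nat.card (MulAction.stabilizer (ConjAct (Equiv.Perm (Fin n))) c.out) : ℚ)

theorem hurwitzNumber_eq {n k : ℕ} (α : Fin k → n.Partition) :
    hurwitzNumber α = Nat.card (sphereCoverings α) / (n ! : ℚ) := by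
  classical
  have e := MulAction.selfEquivSigmaOrbitsQuotientStabilizer
    (ConjAct (Equiv.Perm (Fin n))) (sphereCoverings α)
  have : Fintype (MulAction.orbitRel.Quotient (ConjAct (Equiv.Perm (Fin n)))
    (sphereCoverings α)) := Fintype.ofFinite _
  rw [hurwitzNumber, finsum_eq_sum_of_fintype, Nat.card_congr e, Nat.card_sigma, Nat.cast_sum,
    Finset.sum_div]
  refine Finset.sum_congr rfl fun c _ => ?_
  have h := Subgroup.card_eq_card_quotient_mul_card_subgroup
    (MulAction.stabilizer (ConjAct (Equiv.Perm (Fin n))) c.out)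
  have h0 : Nat.card (ConjAct (Equiv.Perm (Fin n))) = n ! := by
    have : Nat.card (Equiv.Perm (Fin n)) = n ! := by
      rw [Nat.card_eq_fintype_card, Fintype.card_perm, Fintype.card_fin]
    exact this
  rw [h0] at h
  have hs : (Nat.card (MulAction.stabilizer (ConjAct (Equiv.Perm (Fin n))) c.out) : ℚ) ≠ 0 :=
    Nat.cast_ne_zero.2 Nat.card_pos.ne'
  have hn : (n ! : ℚ) ≠ 0 := Nat.cast_ne_zero.2 (Nat.factorial_ne_zero n)
  rw [div_eq_div_iff hs hn, one_mul, h]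
  push_cast
  rfl

theorem card_permType_mul {n : ℕ} (p : n.Partition) :
    Nat.card {s : Equiv.Perm (Fin n) // permType s = p} * autCard p.parts = n ! := by
  obtain ⟨g, rfl⟩ := permType_surjective n p
  have h := Equiv.Perm.card_isConj_mul_eq g
  rw [Fintype.card_fin] at h
  have h1 : Nat.card {s : Equiv.Perm (Fin n) // permType s = permType g} =
      Nat.card {h : Equiv.Perm (Fin n) | IsConj g h} := by
    refine Nat.card_congr (Equiv.subtypeEquivRight fun s => ?_)
    rw [permType_eq_iff, isConj_comm]; rfl
  have h2 : autCard (permType g).parts = (n - g.cycleType.sum)! * g.cycleType.prod *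
      (∏ n ∈ g.cycleType.toFinset, (g.cycleType.count n)!) := by
    change autCard g.partition.parts = _
    rw [Equiv.Perm.parts_partition, ← Equiv.Perm.sum_cycleType, Fintype.card_fin]
    generalize hk : n - g.cycleType.sum = k
    have hc1 : 1 ∉ g.cycleType := fun h => by
      have := Equiv.Perm.two_le_of_mem_cycleType h; omega
    have hc0 : g.cycleType.count 1 = 0 := Multiset.count_eq_zero.2 hc1
    have hrest : ∀ j ∈ g.cycleType.toFinset,
        (g.cycleType + Multiset.replicate k 1).count j = g.cycleType.count j := by
      intro j hj
      rw [Multiset.count_add, Multiset.count_replicate, if_neg, add_zero]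
      rintro rfl
      exact hc1 (Multiset.mem_toFinset.1 hj)
    have hsub : (g.cycleType + Multiset.replicate k 1).toFinset ⊆ insert 1 g.cycleType.toFinset := by
      intro j hj
      rw [Multiset.mem_toFinset, Multiset.mem_add] at hj
      rw [Finset.mem_insert, Multiset.mem_toFinset]
      rcases hj with hj | hj
      · exact Or.inr hj
      · exact Or.inl (Multiset.eq_of_mem_replicate hj)
    rw [autCard, Finset.prod_subset hsub, Finset.prod_insert (by simpa using hc1),
      Finset.prod_congr rfl (fun j hj => by rw [hrest j hj]), Finset.prod_mul_distrib,
      ← Finset.prod_multiset_count]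
    · rw [Multiset.count_add, hc0, Multiset.count_replicate_self]
      simp only [zero_add, one_pow, mul_one]
      ring
    · intro j _ hj
      rw [Multiset.mem_toFinset] at hj
      rw [Multiset.count_eq_zero.2 hj]
      simp
  rw [h1, h2, ← h]

/-- The space `A_n` with basis the Young diagrams of degree `n`. -/
def YoungAlgebra (n : ℕ) : Type := n.Partition → ℂ

namespace YoungAlgebra

variable {n : ℕ}

instance : AddCommGroup (YoungAlgebra n) := inferInstanceAs (AddCommGroup (n.Partition → ℂ))
instance : Module ℂ (YoungAlgebra n) := inferInstanceAs (Module ℂ (n.Partition → ℂ))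

@[ext] theorem ext {a b : YoungAlgebra n} (h : ∀ p, a p = b p) : a = b := funext h

/-- A Young diagram as a basis element of `A_n`. -/
def diagram (p : n.Partition) : YoungAlgebra n := fun q => if q = p then 1 else 0

/-- The bilinear form on `A_n` given on Young diagrams by the two-point Hurwitz numbers of the
sphere. -/
def form (a b : YoungAlgebra n) : ℂ :=
  ∑ p : n.Partition, ∑ q : n.Partition, a p * b q * (hurwitzNumber ![p, q] : ℂ)

/-- The product `*` of `A_n`: on Young diagrams
`Δ₁ * Δ₂ = ∑ Δ₃, |Aut Δ₃| H(S, {Δ₁, Δ₂, Δ₃}) Δ₃`, extended bilinearly. -/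
instance : Mul (YoungAlgebra n) where
  mul a b := fun r => ∑ p : n.Partition, ∑ q : n.Partition,
    a p * b q * (autCard r.parts * (hurwitzNumber ![p, q, r] : ℂ))

/-- The unit of `A_n`: the Young diagram with all lines of unit length. -/
instance : One (YoungAlgebra n) where
  one := diagram (permType 1)

theorem add_apply (a b : YoungAlgebra n) (p : n.Partition) : (a + b) p = a p + b p := rfl
theorem zero_apply (p : n.Partition) : (0 : YoungAlgebra n) p = 0 := rfl
theorem smul_apply (c : ℂ) (a : YoungAlgebra n) (p : n.Partition) : (c • a) p = c * a p := rfl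

theorem mul_apply (a b : YoungAlgebra n) (r : n.Partition) :
    (a * b) r = ∑ p : n.Partition, ∑ q : n.Partition,
      a p * b q * (autCard r.parts * (hurwitzNumber ![p, q, r] : ℂ)) := rfl

theorem autCard_ne_zero (p : n.Partition) : (autCard p.parts : ℂ) ≠ 0 := by
  have h := card_permType_mul p
  intro h0
  rw [Nat.cast_eq_zero] at h0
  rw [h0, mul_zero] at h
  exact Nat.factorial_ne_zero n h.symm

theorem hurwitzNumber_two (p q : n.Partition) :
    (hurwitzNumber ![p, q] : ℂ) = if p = q then 1 / (autCard p.parts : ℂ) else 0 := by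
  have hp := card_permType_mul p
  have hn : (n ! : ℂ) ≠ 0 := Nat.cast_ne_zero.2 (Nat.factorial_ne_zero n)
  have hinv : ∀ u : sphereCoverings ![p, q], u.1 1 = (u.1 0)⁻¹ := by
    intro u
    have h := u.2.2
    simp only [List.ofFn_succ, List.ofFn_zero, List.prod_cons, List.prod_nil, mul_one] at h
    exact eq_inv_of_mul_eq_one_right h
  rw [hurwitzNumber_eq]
  split_ifs with h
  · subst h
    have e : sphereCoverings ![p, p] ≃ {s : Equiv.Perm (Fin n) // permType s = p} :=
      { toFun := fun u => ⟨u.1 0, u.2.1 0⟩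
        invFun := fun s => ⟨![s.1, s.1⁻¹], by
          refine ⟨fun i => ?_, ?_⟩
          · fin_cases i
            · exact s.2
            · exact (permType_inv _).trans s.2
          · simp [List.ofFn_succ]⟩
        left_inv := fun u => by
          apply Subtype.ext
          funext i
          fin_cases i
          · rfl
          · exact (hinv u).symm
        right_inv := fun s => rfl }
    rw [Nat.card_congr e]
    push_cast
    rw [div_eq_div_iff hn (autCard_ne_zero p), one_mul]
    exact_mod_cast hp
  · have : IsEmpty (sphereCoverings ![p, q]) := by
      refine ⟨fun u => h ?_⟩
      have h0 : permType (u.1 0) = p := u.2.1 0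
      have h1 : permType (u.1 1) = q := u.2.1 1
      exact h0.symm.trans (((congrArg permType (hinv u)).trans (permType_inv _)).symm.trans h1)
    simp

/-- The defining property of the product: its matrix elements with respect to the form are the
three-point Hurwitz numbers. -/
theorem form_mul_diagram (p q r : n.Partition) :
    form (diagram p * diagram q) (diagram r) = (hurwitzNumber ![p, q, r] : ℂ) := by
  simp only [form, mul_apply, diagram, ite_mul, one_mul, zero_mul, mul_ite, mul_one, mul_zero,
    Finset.sum_ite_eq', Finset.mem_univ, if_true, hurwitzNumber_two]
  simp only [Finset.sum_ite_eq, Finset.sum_ite_eq', Finset.mem_univ, if_true]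
  rw [mul_one_div, mul_div_cancel_left₀ _ (autCard_ne_zero r)]

theorem card_conj_invariant (p q : n.Partition) {s t : Equiv.Perm (Fin n)}
    (h : permType s = permType t) :
    Nat.card {x : Equiv.Perm (Fin n) // permType x = p ∧ permType (x⁻¹ * s) = q} =
      Nat.card {x : Equiv.Perm (Fin n) // permType x = p ∧ permType (x⁻¹ * t) = q} := by
  obtain ⟨g, rfl⟩ := isConj_iff.1 ((permType_eq_iff s t).1 h)
  refine Nat.card_congr ((MulAut.conj g).toEquiv.subtypeEquiv fun x => ?_)
  have : (MulAut.conj g x)⁻¹ * (g * s * g⁻¹) = g * (x⁻¹ * s) * g⁻¹ := by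
    rw [MulAut.conj_apply]; group
  change _ ↔ permType (MulAut.conj g x) = p ∧ permType ((MulAut.conj g x)⁻¹ * (g * s * g⁻¹)) = q
  rw [this, permType_conj, MulAut.conj_apply, permType_conj]

theorem structure_constant (p q : n.Partition) (s : Equiv.Perm (Fin n)) :
    (autCard (permType s).parts * (hurwitzNumber ![p, q, permType s] : ℂ)) =
      Nat.card {x : Equiv.Perm (Fin n) // permType x = p ∧ permType (x⁻¹ * s) = q} := by
  classical
  have e : sphereCoverings ![p, q, permType s] ≃
      Σ w : {w : Equiv.Perm (Fin n) // permType w = permType s},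
        {x : Equiv.Perm (Fin n) // permType x = p ∧ permType (x⁻¹ * w.1⁻¹) = q} :=
    { toFun := fun u => ⟨⟨u.1 2, u.2.1 2⟩, ⟨u.1 0, u.2.1 0, by
        have h := u.2.2
        have h1 := u.2.1 1
        simp only [List.ofFn_succ, List.ofFn_zero, List.prod_cons, List.prod_nil, mul_one] at h
        change u.1 0 * (u.1 1 * u.1 2) = 1 at h
        have : (u.1 0)⁻¹ * (u.1 2)⁻¹ = u.1 1 := by
          rw [← mul_assoc] at h
          rw [← eq_inv_of_mul_eq_one_left h]; group
        rw [this]; exact h1⟩⟩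
      invFun := fun v => ⟨![v.2.1, v.2.1⁻¹ * v.1.1⁻¹, v.1.1], by
        refine ⟨fun i => ?_, ?_⟩
        · fin_cases i
          · exact v.2.2.1
          · exact v.2.2.2
          · exact v.1.2
        · simp [List.ofFn_succ]⟩
      left_inv := fun u => by
        have h := u.2.2
        simp only [List.ofFn_succ, List.ofFn_zero, List.prod_cons, List.prod_nil, mul_one] at h
        change u.1 0 * (u.1 1 * u.1 2) = 1 at h
        have : (u.1 0)⁻¹ * (u.1 2)⁻¹ = u.1 1 := by
          rw [← mul_assoc] at h
          rw [← eq_inv_of_mul_eq_one_left h]; group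
        apply Subtype.ext
        funext i
        fin_cases i
        · rfl
        · exact this
        · rfl
      right_inv := fun v => rfl }
  have hc : Nat.card (sphereCoverings ![p, q, permType s]) =
      Nat.card {w : Equiv.Perm (Fin n) // permType w = permType s} *
        Nat.card {x : Equiv.Perm (Fin n) // permType x = p ∧ permType (x⁻¹ * s) = q} := by
    rw [Nat.card_congr e, Nat.card_sigma,
      Finset.sum_congr rfl (fun (w : {w : Equiv.Perm (Fin n) // permType w = permType s}) _ =>
        card_conj_invariant p q (s := w.1⁻¹) (t := s) ((permType_inv _).trans w.2))]
    simp
  have hz := card_permType_mul (permType s)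
  have hn : (n ! : ℂ) ≠ 0 := Nat.cast_ne_zero.2 (Nat.factorial_ne_zero n)
  rw [hurwitzNumber_eq, hc]
  push_cast
  rw [mul_div_assoc', div_eq_iff hn, ← hz]
  push_cast
  ring

/-- In terms of class functions the product is the convolution on the symmetric group. -/
theorem mul_permType (a b : YoungAlgebra n) (s : Equiv.Perm (Fin n)) :
    (a * b) (permType s) = ∑ x : Equiv.Perm (Fin n), a (permType x) * b (permType (x⁻¹ * s)) := by
  classical
  rw [mul_apply]
  have h : ∀ x : Equiv.Perm (Fin n), a (permType x) * b (permType (x⁻¹ * s)) =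
      ∑ p : n.Partition, ∑ q : n.Partition,
        if permType x = p ∧ permType (x⁻¹ * s) = q then a p * b q else 0 := by
    intro x
    simp [ite_and]
  rw [Fintype.sum_congr _ _ h]
  conv_rhs => rw [Finset.sum_comm]
  refine Fintype.sum_congr _ _ fun p => ?_
  conv_rhs => rw [Finset.sum_comm]
  refine Fintype.sum_congr _ _ fun q => ?_
  rw [structure_constant, ← Finset.sum_filter, Finset.sum_const, nsmul_eq_mul,
    Nat.card_eq_fintype_card, Fintype.card_subtype, mul_comm]

theorem ext_permType {a b : YoungAlgebra n} (h : ∀ s, a (permType s) = b (permType s)) :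
    a = b := by
  ext p
  obtain ⟨s, rfl⟩ := permType_surjective n p
  exact h s

theorem one_permType (s : Equiv.Perm (Fin n)) :
    (1 : YoungAlgebra n) (permType s) = if s = 1 then 1 else 0 := by
  change (if permType s = permType 1 then (1 : ℂ) else 0) = _
  have : permType s = permType 1 ↔ s = 1 := by
    rw [permType_eq_iff, isConj_comm, isConj_one_right]
  simp only [this]

theorem mul_comm_aux (a b : YoungAlgebra n) : a * b = b * a := by
  refine ext_permType fun s => ?_
  rw [mul_permType, mul_permType]
  refine Fintype.sum_equiv ((Equiv.inv _).trans (Equiv.mulRight s)) _ _ fun x => ?_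
  change _ = b (permType (x⁻¹ * s)) * a (permType ((x⁻¹ * s)⁻¹ * s))
  have : (x⁻¹ * s)⁻¹ * s = s⁻¹ * x * s⁻¹⁻¹ := by group
  rw [this, permType_conj, mul_comm]

theorem one_mul_aux (a : YoungAlgebra n) : 1 * a = a := by
  refine ext_permType fun s => ?_
  rw [mul_permType]
  simp [one_permType]

theorem mul_assoc_aux (a b c : YoungAlgebra n) : a * b * c = a * (b * c) := by
  refine ext_permType fun s => ?_
  simp only [mul_permType, Finset.sum_mul, Finset.mul_sum]
  rw [Finset.sum_comm]
  refine Finset.sum_congr rfl fun y _ => ?_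
  refine Fintype.sum_equiv (Equiv.mulLeft y⁻¹) _ _ fun x => ?_
  simp [mul_assoc]

instance : CommRing (YoungAlgebra n) where
  __ := (inferInstance : AddCommGroup (YoungAlgebra n))
  mul_comm := mul_comm_aux
  one_mul := one_mul_aux
  mul_one a := by rw [mul_comm_aux, one_mul_aux]
  mul_assoc := mul_assoc_aux
  left_distrib a b c := by
    refine ext_permType fun s => ?_
    simp only [add_apply, mul_permType, mul_add, Finset.sum_add_distrib]
  right_distrib a b c := by
    refine ext_permType fun s => ?_
    simp only [add_apply, mul_permType, add_mul, Finset.sum_add_distrib]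
  zero_mul a := by
    refine ext_permType fun s => ?_
    simp [zero_apply, mul_permType]
  mul_zero a := by
    refine ext_permType fun s => ?_
    simp [zero_apply, mul_permType]

instance : Algebra ℂ (YoungAlgebra n) := Algebra.ofModule
  (fun c a b => by
    refine ext_permType fun s => ?_
    simp only [smul_apply, mul_permType, Finset.mul_sum, mul_assoc])
  (fun c a b => by
    refine ext_permType fun s => ?_
    simp only [smul_apply, mul_permType, Finset.mul_sum, mul_left_comm])

end YoungAlgebra

/-- An element of the semigroup `D_∞`: a finite set `dom` of natural numbers with a permutation of
it, stored as the permutation `perm` of all natural numbers that fixes everything outside `dom`. -/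
@[ext] structure PartialPerm where
  dom : Finset ℕ
  perm : Equiv.Perm ℕ
  perm_eq : ∀ x ∉ dom, perm x = x

namespace PartialPerm

instance : Mul PartialPerm where
  mul p q := ⟨p.dom ∪ q.dom, p.perm * q.perm, fun x hx => by
    rw [Finset.mem_union, not_or] at hx
    rw [Equiv.Perm.mul_apply, q.perm_eq x hx.2, p.perm_eq x hx.1]⟩

instance : One PartialPerm where
  one := ⟨∅, 1, fun _ _ => rfl⟩

instance : Monoid PartialPerm where
  mul_assoc p q r := PartialPerm.ext (Finset.union_assoc _ _ _) (mul_assoc _ _ _)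
  one_mul p := PartialPerm.ext (Finset.empty_union _) (one_mul _)
  mul_one p := PartialPerm.ext (Finset.union_empty _) (mul_one _)

theorem perm_mem_iff (p : PartialPerm) (x : ℕ) : p.perm x ∈ p.dom ↔ x ∈ p.dom := by
  constructor
  · intro h
    by_contra hx
    rw [p.perm_eq x hx] at h
    exact hx h
  · intro h
    by_contra hx
    have := p.perm.injective (p.perm_eq _ hx)
    rw [this] at hx
    exact hx h

/-- The permutation of the set `dom`. -/
def restrict (p : PartialPerm) : Equiv.Perm p.dom := p.perm.subtypePerm p.perm_mem_iff

/-- The Young diagram `[d, σ]` of degree `|d|`, as the multiset of its line lengths: the cycle type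
of `σ` on `d`, fixed points included. -/
def type (p : PartialPerm) : Multiset ℕ := p.restrict.partition.parts

theorem type_sum (p : PartialPerm) : p.type.sum = p.dom.card := by
  rw [type, p.restrict.partition.parts_sum, Fintype.card_coe]

/-- The action of a permutation of the natural numbers by conjugation. -/
def conj (g : Equiv.Perm ℕ) (p : PartialPerm) : PartialPerm where
  dom := p.dom.map g.toEmbedding
  perm := g * p.perm * g⁻¹
  perm_eq x hx := by
    have : g⁻¹ x ∉ p.dom := fun h => hx (Finset.mem_map.2 ⟨g⁻¹ x, h, by simp⟩)
    rw [Equiv.Perm.mul_apply, Equiv.Perm.mul_apply, p.perm_eq _ this]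
    exact g.apply_symm_apply x

theorem conj_mul (g : Equiv.Perm ℕ) (p q : PartialPerm) :
    conj g (p * q) = conj g p * conj g q := by
  refine PartialPerm.ext (Finset.map_union _ _) ?_
  change g * (p.perm * q.perm) * g⁻¹ = (g * p.perm * g⁻¹) * (g * q.perm * g⁻¹)
  group

theorem conj_conj_inv (g : Equiv.Perm ℕ) (p : PartialPerm) : conj g (conj g⁻¹ p) = p := by
  refine PartialPerm.ext ?_ ?_
  · change (p.dom.map g⁻¹.toEmbedding).map g.toEmbedding = p.dom
    ext x
    simp only [Finset.mem_map, Equiv.coe_toEmbedding]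
    constructor
    · rintro ⟨_, ⟨y, hy, rfl⟩, rfl⟩
      rwa [show g (g⁻¹ y) = y from g.apply_symm_apply y]
    · exact fun hx => ⟨_, ⟨x, hx, rfl⟩, g.apply_symm_apply x⟩
  · change g * (g⁻¹ * p.perm * g⁻¹⁻¹) * g⁻¹ = p.perm
    group

theorem cycleType_permCongr {α β : Type} [Fintype α] [DecidableEq α] [Fintype β]
    [DecidableEq β] (e : α ≃ β) (s : Equiv.Perm α) :
    (e.permCongr s).cycleType = s.cycleType := by
  rw [← Equiv.Perm.cycleType_extendDomain
    (e.trans (Equiv.subtypeUnivEquiv (p := fun _ : β => True) fun _ => trivial).symm) (g := s)]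
  congr 1

theorem type_eq_of_equiv {p q : PartialPerm} (e : p.dom ≃ q.dom)
    (he : e.permCongr p.restrict = q.restrict) : p.type = q.type := by
  have h1 : p.restrict.cycleType = q.restrict.cycleType := by
    rw [← he, cycleType_permCongr]
  have h2 : Fintype.card p.dom = Fintype.card q.dom := Fintype.card_congr e
  rw [type, type, Equiv.Perm.parts_partition, Equiv.Perm.parts_partition,
    ← Equiv.Perm.sum_cycleType, ← Equiv.Perm.sum_cycleType, h1, h2]

theorem type_conj (g : Equiv.Perm ℕ) (p : PartialPerm) : (conj g p).type = p.type := by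
  symm
  refine type_eq_of_equiv (g.subtypeEquiv fun x => ?_) ?_
  · simp [conj]
  · ext x
    rfl

theorem exists_conj {p q : PartialPerm} (h : p.type = q.type) : ∃ g, conj g p = q := by
  have hcard : Fintype.card p.dom = Fintype.card q.dom := by
    rw [Fintype.card_coe, Fintype.card_coe, ← type_sum, ← type_sum, h]
  let e₀ : p.dom ≃ q.dom := Fintype.equivOfCardEq hcard
  have h1 : (e₀.permCongr p.restrict).cycleType = q.restrict.cycleType := by
    rw [← Equiv.Perm.filter_parts_partition_eq_cycleType (σ := q.restrict)]
    change _ = q.type.filter _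
    rw [← h]
    change _ = p.restrict.partition.parts.filter _
    rw [Equiv.Perm.filter_parts_partition_eq_cycleType, cycleType_permCongr]
  obtain ⟨c, hc⟩ := isConj_iff.1 (Equiv.Perm.isConj_iff_cycleType_eq.2 h1)
  let e : p.dom ≃ q.dom := e₀.trans c
  have he : ∀ x, e (p.restrict x) = q.restrict (e x) := by
    intro x
    rw [← hc]
    simp [e]
  have hinf : ∀ s : Finset ℕ, Infinite {x // ¬ x ∈ s} := fun s =>
    Set.infinite_coe_iff.2 (s.finite_toSet.infinite_compl)
  have := hinf p.dom
  have := hinf q.dom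
  have : Nonempty ({x // ¬ x ∈ p.dom} ≃ {x // ¬ x ∈ q.dom}) := nonempty_equiv_of_countable
  obtain ⟨e'⟩ := this
  let g : Equiv.Perm ℕ := ((Equiv.sumCompl (fun x => x ∈ p.dom)).symm.trans
    (Equiv.sumCongr e e')).trans (Equiv.sumCompl (fun x => x ∈ q.dom))
  have hg1 : ∀ x (hx : x ∈ p.dom), g x = e ⟨x, hx⟩ := by
    intro x hx
    simp [g, Equiv.sumCompl_symm_apply_of_pos hx]
  have hg2 : ∀ x (hx : x ∉ p.dom), g x ∉ q.dom := by
    intro x hx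
    simp only [g, Equiv.trans_apply]
    rw [Equiv.sumCompl_symm_apply_of_neg hx]
    exact (e' ⟨x, hx⟩).2
  refine ⟨g, PartialPerm.ext ?_ ?_⟩
  · ext y
    change y ∈ p.dom.map _ ↔ _
    rw [Finset.mem_map]
    constructor
    · rintro ⟨x, hx, rfl⟩
      change g x ∈ _
      rw [hg1 x hx]
      exact (e _).2
    · intro hy
      refine ⟨g.symm y, ?_, g.apply_symm_apply y⟩
      by_contra hx
      exact hg2 _ hx (by rwa [g.apply_symm_apply])
  · change g * p.perm * g⁻¹ = q.perm
    rw [mul_inv_eq_iff_eq_mul]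
    ext x
    rw [Equiv.Perm.mul_apply, Equiv.Perm.mul_apply]
    by_cases hx : x ∈ p.dom
    · have h3 := he ⟨x, hx⟩
      have h4 : p.restrict ⟨x, hx⟩ = ⟨p.perm x, (p.perm_mem_iff x).2 hx⟩ := rfl
      rw [hg1 x hx, hg1 _ ((p.perm_mem_iff x).2 hx), ← h4, h3]
      rfl
    · rw [p.perm_eq x hx, q.perm_eq _ (hg2 x hx)]

theorem finite_dom_subset (s : Finset ℕ) : {p : PartialPerm | p.dom ⊆ s}.Finite := by
  have hmem : ∀ p : {p : PartialPerm | p.dom ⊆ s}, ∀ x, p.1.perm x ∈ s ↔ x ∈ s := by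
    intro p x
    by_cases hx : x ∈ p.1.dom
    · exact ⟨fun _ => p.2 hx, fun _ => p.2 ((p.1.perm_mem_iff x).2 hx)⟩
    · rw [p.1.perm_eq x hx]
  refine Set.finite_coe_iff.1 (Finite.of_injective
    (β := s.powerset × Equiv.Perm s)
    (fun p => (⟨p.1.dom, Finset.mem_powerset.2 p.2⟩, p.1.perm.subtypePerm (hmem p))) ?_)
  intro p q h
  rw [Prod.mk.injEq] at h
  have h1 : p.1.dom = q.1.dom := congrArg Subtype.val h.1
  refine Subtype.ext (PartialPerm.ext h1 (Equiv.ext fun x => ?_))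
  by_cases hx : x ∈ s
  · exact congrArg Subtype.val (Equiv.congr_fun h.2 ⟨x, hx⟩)
  · rw [p.1.perm_eq x fun h => hx (p.2 h), q.1.perm_eq x fun h => hx (q.2 h)]

theorem finite_factorizations (p : PartialPerm) :
    {u : PartialPerm × PartialPerm | u.1 * u.2 = p}.Finite := by
  refine ((finite_dom_subset p.dom).prod (finite_dom_subset p.dom)).subset ?_
  rintro u rfl
  exact ⟨Finset.subset_union_left, Finset.subset_union_right⟩

/-- The finitely many ways to write a partial permutation as a product of two. -/
def factorizations (p : PartialPerm) : Finset (PartialPerm × PartialPerm) :=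
  p.finite_factorizations.toFinset

theorem mem_factorizations {p : PartialPerm} {u : PartialPerm × PartialPerm} :
    u ∈ p.factorizations ↔ u.1 * u.2 = p := by
  simp [factorizations]

end PartialPerm

/-- The completed semigroup algebra of `D_∞`: formal, possibly infinite, sums
`∑ p, f p • p` of elements of `D_∞` with complex coefficients. -/
def FormalSum : Type := PartialPerm → ℂ

namespace FormalSum

open PartialPerm

instance : AddCommGroup FormalSum := inferInstanceAs (AddCommGroup (PartialPerm → ℂ))
instance : Module ℂ FormalSum := inferInstanceAs (Module ℂ (PartialPerm → ℂ))

@[ext] theorem ext {f g : FormalSum} (h : ∀ p, f p = g p) : f = g := funext h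

/-- The product of formal sums, which extends the product of `D_∞` bilinearly. -/
instance : Mul FormalSum where
  mul f g := fun p => ∑ u ∈ p.factorizations, f u.1 * g u.2

open Classical in
instance : One FormalSum where
  one := fun p => if p = 1 then 1 else 0

theorem mul_apply (f g : FormalSum) (p : PartialPerm) :
    (f * g) p = ∑ u ∈ p.factorizations, f u.1 * g u.2 := rfl
open Classical in
theorem one_apply (p : PartialPerm) : (1 : FormalSum) p = if p = 1 then 1 else 0 := rfl
theorem add_apply (f g : FormalSum) (p : PartialPerm) : (f + g) p = f p + g p := rfl
theorem zero_apply (p : PartialPerm) : (0 : FormalSum) p = 0 := rfl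
theorem smul_apply (c : ℂ) (f : FormalSum) (p : PartialPerm) : (c • f) p = c * f p := rfl

theorem mul_assoc_aux (f g h : FormalSum) : f * g * h = f * (g * h) := by
  ext p
  simp only [mul_apply, Finset.sum_mul, Finset.mul_sum]
  rw [Finset.sum_sigma', Finset.sum_sigma']
  refine Finset.sum_nbij'
    (fun w => (⟨(w.2.1, w.2.2 * w.1.2), (w.2.2, w.1.2)⟩ :
      Σ _ : PartialPerm × PartialPerm, PartialPerm × PartialPerm))
    (fun w => (⟨(w.1.1 * w.2.1, w.2.2), (w.1.1, w.2.1)⟩ :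
      Σ _ : PartialPerm × PartialPerm, PartialPerm × PartialPerm)) ?_ ?_ ?_ ?_ ?_
  · rintro ⟨⟨x, c⟩, ⟨a, b⟩⟩ hw
    simp only [Finset.mem_sigma, mem_factorizations] at hw ⊢
    exact ⟨by rw [← mul_assoc, hw.2, hw.1], trivial⟩
  · rintro ⟨⟨a, y⟩, ⟨b, c⟩⟩ hw
    simp only [Finset.mem_sigma, mem_factorizations] at hw ⊢
    exact ⟨by rw [mul_assoc, hw.2, hw.1], trivial⟩
  · rintro ⟨⟨x, c⟩, ⟨a, b⟩⟩ hw
    simp only [Finset.mem_sigma, mem_factorizations] at hw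
    simp [hw.2]
  · rintro ⟨⟨a, y⟩, ⟨b, c⟩⟩ hw
    simp only [Finset.mem_sigma, mem_factorizations] at hw
    simp [hw.2]
  · rintro ⟨⟨x, c⟩, ⟨a, b⟩⟩ _
    exact mul_assoc _ _ _

theorem one_mul_aux (f : FormalSum) : 1 * f = f := by
  ext p
  rw [mul_apply, Finset.sum_eq_single (1, p)]
  · simp [one_apply]
  · rintro ⟨a, b⟩ hu hne
    rw [mem_factorizations] at hu
    rw [one_apply, if_neg, zero_mul]
    rintro rfl
    exact hne (by rw [← hu, one_mul])
  · intro h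
    exact absurd (mem_factorizations.2 (one_mul p)) h

theorem mul_one_aux (f : FormalSum) : f * 1 = f := by
  ext p
  rw [mul_apply, Finset.sum_eq_single (p, 1)]
  · simp [one_apply]
  · rintro ⟨a, b⟩ hu hne
    rw [mem_factorizations] at hu
    rw [one_apply, if_neg, mul_zero]
    rintro rfl
    exact hne (by rw [← hu, mul_one])
  · intro h
    exact absurd (mem_factorizations.2 (mul_one p)) h

instance : Ring FormalSum where
  __ := (inferInstance : AddCommGroup FormalSum)
  one_mul := one_mul_aux
  mul_one := mul_one_aux
  mul_assoc := mul_assoc_aux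
  left_distrib f g h := by
    ext p
    simp only [add_apply, mul_apply, mul_add, Finset.sum_add_distrib]
  right_distrib f g h := by
    ext p
    simp only [add_apply, mul_apply, add_mul, Finset.sum_add_distrib]
  zero_mul f := by
    ext p
    simp [zero_apply, mul_apply]
  mul_zero f := by
    ext p
    simp [zero_apply, mul_apply]

instance : Algebra ℂ FormalSum := Algebra.ofModule
  (fun c f g => by
    ext p
    simp only [smul_apply, mul_apply, Finset.mul_sum, mul_assoc])
  (fun c f g => by
    ext p
    simp only [smul_apply, mul_apply, Finset.mul_sum, mul_left_comm])

/-- The sum `∑ (d, σ)` over all elements of `D_∞` with `[d, σ] = Δ`. -/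
def classSum {n : ℕ} (Δ : n.Partition) : FormalSum := fun p => if p.type = Δ.parts then 1 else 0

/-- The linear span of the class sums of all Young diagrams. -/
def classSpan : Submodule ℂ FormalSum :=
  Submodule.span ℂ (Set.range fun Δ : Σ n, Nat.Partition n => classSum Δ.2)

theorem classSum_mem {n : ℕ} (Δ : n.Partition) : classSum Δ ∈ classSpan :=
  Submodule.subset_span ⟨⟨n, Δ⟩, rfl⟩

/-- The span of the class sums consists of the conjugation invariant formal sums of bounded
degree. -/
theorem mem_classSpan_iff (f : FormalSum) : f ∈ classSpan ↔
    (∃ N, ∀ p : PartialPerm, N < p.dom.card → f p = 0) ∧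
      ∀ p q : PartialPerm, p.type = q.type → f p = f q := by
  constructor
  · intro hf
    refine Submodule.span_induction ?_ ?_ ?_ ?_ hf
    · rintro _ ⟨⟨n, Δ⟩, rfl⟩
      refine ⟨⟨n, fun p hp => if_neg fun h => ?_⟩, fun p q h => ?_⟩
      · have := p.type_sum
        rw [h, Δ.parts_sum] at this
        omega
      · simp only [classSum, h]
    · exact ⟨⟨0, fun _ _ => rfl⟩, fun _ _ _ => rfl⟩
    · rintro f g _ _ ⟨⟨N, hN⟩, hf⟩ ⟨⟨M, hM⟩, hg⟩
      refine ⟨⟨max N M, fun p hp => ?_⟩, fun p q h => ?_⟩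
      · rw [add_apply, hN p (lt_of_le_of_lt (le_max_left _ _) hp),
          hM p (lt_of_le_of_lt (le_max_right _ _) hp), add_zero]
      · rw [add_apply, add_apply, hf p q h, hg p q h]
    · rintro c f _ ⟨⟨N, hN⟩, hf⟩
      refine ⟨⟨N, fun p hp => ?_⟩, fun p q h => ?_⟩
      · rw [smul_apply, hN p hp, mul_zero]
      · rw [smul_apply, smul_apply, hf p q h]
  · rintro ⟨⟨N, hN⟩, hf⟩
    obtain ⟨F, hF⟩ : ∃ F : Multiset ℕ → ℂ, ∀ p : PartialPerm, F p.type = f p :=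
      ⟨Function.extend (β := Multiset ℕ) (γ := ℂ) type (fun p => f p) 0, fun p =>
        Function.FactorsThrough.extend_apply (fun a b h => hf a b h) 0 p⟩
    have key : f = ∑ k ∈ Finset.range (N + 1), ∑ Δ : Nat.Partition k,
        F Δ.parts • classSum Δ := by
      ext p
      have hs : (∑ k ∈ Finset.range (N + 1), ∑ Δ : Nat.Partition k,
          F Δ.parts • classSum Δ) p =
          ∑ k ∈ Finset.range (N + 1), ∑ Δ : Nat.Partition k,
            if p.type = Δ.parts then F Δ.parts else 0 := by
        have hev : ∃ ev : FormalSum →+ ℂ, ∀ f, ev f = f p := ⟨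
          { toFun := fun f => f p, map_zero' := rfl, map_add' := fun _ _ => rfl }, fun _ => rfl⟩
        obtain ⟨ev, hev⟩ := hev
        refine (hev _).symm.trans ?_
        rw [map_sum]
        refine Finset.sum_congr rfl fun k _ => ?_
        rw [map_sum]
        refine Finset.sum_congr rfl fun Δ _ => ?_
        rw [hev, smul_apply, classSum, mul_ite, mul_one, mul_zero]
      rw [hs]
      by_cases hp : N < p.dom.card
      · rw [hN p hp]
        refine (Finset.sum_eq_zero fun k hk => Finset.sum_eq_zero fun Δ _ => if_neg fun h => ?_).symm
        have := p.type_sum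
        rw [h, Δ.parts_sum] at this
        rw [Finset.mem_range] at hk
        omega
      · let Δ₀ : Nat.Partition p.dom.card :=
          ⟨p.type, p.restrict.partition.parts_pos, p.type_sum⟩
        rw [Finset.sum_eq_single p.dom.card, Finset.sum_eq_single Δ₀]
        · rw [if_pos rfl, hF]
        · intro Δ _ hne
          exact if_neg fun h => hne (Nat.Partition.ext h.symm)
        · intro h
          exact absurd (Finset.mem_univ _) h
        · intro k _ hne
          refine Finset.sum_eq_zero fun Δ _ => if_neg fun h => hne ?_
          rw [← p.type_sum, h, Δ.parts_sum]
        · intro h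
          rw [Finset.mem_range] at h
          omega
    rw [key]
    exact Submodule.sum_mem _ fun k _ => Submodule.sum_mem _ fun Δ _ =>
      Submodule.smul_mem _ _ (classSum_mem Δ)

theorem mul_mem_classSpan {f g : FormalSum} (hf : f ∈ classSpan) (hg : g ∈ classSpan) :
    f * g ∈ classSpan := by
  rw [mem_classSpan_iff] at *
  obtain ⟨⟨N, hN⟩, hf⟩ := hf
  obtain ⟨⟨M, hM⟩, hg⟩ := hg
  refine ⟨⟨N + M, fun p hp => ?_⟩, fun p q h => ?_⟩
  · rw [mul_apply]
    refine Finset.sum_eq_zero fun u hu => ?_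
    rw [mem_factorizations] at hu
    have h1 : p.dom.card ≤ u.1.dom.card + u.2.dom.card := by
      rw [← hu]
      exact Finset.card_union_le _ _
    by_cases h2 : N < u.1.dom.card
    · rw [hN _ h2, zero_mul]
    · rw [hM _ (by omega), mul_zero]
  · obtain ⟨c, rfl⟩ := exists_conj h
    rw [mul_apply, mul_apply]
    refine Finset.sum_nbij' (fun u => (conj c u.1, conj c u.2))
      (fun u => (conj c⁻¹ u.1, conj c⁻¹ u.2)) ?_ ?_ ?_ ?_ ?_
    · intro u hu
      rw [mem_factorizations] at hu ⊢
      rw [← conj_mul, hu]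
    · intro u hu
      rw [mem_factorizations] at hu ⊢
      have := conj_conj_inv c⁻¹ p
      rw [inv_inv] at this
      rw [← conj_mul, hu, this]
    · intro u _
      have := conj_conj_inv c⁻¹
      rw [inv_inv] at this
      simp [this]
    · intro u _
      simp [conj_conj_inv]
    · intro u _
      rw [hf _ _ (type_conj c u.1), hg _ _ (type_conj c u.2)]

theorem one_mem_classSpan : (1 : FormalSum) ∈ classSpan := by
  have : (1 : FormalSum) = classSum (n := 0) ⟨0, by simp, by simp⟩ := by
    ext p
    classical
    rw [one_apply, classSum]
    refine if_congr ⟨?_, ?_⟩ rfl rfl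
    · rintro rfl
      refine Multiset.eq_zero_of_forall_notMem fun i hi => ?_
      have h1 := Multiset.le_sum_of_mem hi
      have h2 : 0 < i := (restrict 1).partition.parts_pos hi
      rw [type_sum] at h1
      change i ≤ 0 at h1
      omega
    · intro h
      have h1 := p.type_sum
      rw [h, Multiset.sum_zero, eq_comm, Finset.card_eq_zero] at h1
      refine PartialPerm.ext h1 (Equiv.ext fun x => p.perm_eq x ?_)
      rw [h1]
      exact Finset.notMem_empty x
  rw [this]
  exact classSum_mem _

end FormalSum

/-- The Ivanov–Kerov algebra `A_∞`, spanned by the class sums of all Young diagrams, with the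
multiplication of formal sums. The class sum of the empty diagram is the unit. -/
def IvanovKerovAlgebra : Subalgebra ℂ FormalSum where
  carrier := FormalSum.classSpan
  mul_mem' := FormalSum.mul_mem_classSpan
  add_mem' := FormalSum.classSpan.add_mem
  algebraMap_mem' c := by
    rw [Algebra.algebraMap_eq_smul_one]
    exact FormalSum.classSpan.smul_mem c FormalSum.one_mem_classSpan

/-- The embedding of the vector space `A_m` in `A_∞`, which sends a Young diagram to its class
sum. -/
def toIvanovKerov (m : ℕ) : YoungAlgebra m →ₗ[ℂ] IvanovKerovAlgebra where
  toFun a := ∑ Δ : m.Partition, a Δ • ⟨FormalSum.classSum Δ, FormalSum.classSum_mem Δ⟩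
  map_add' a b := by
    simp only [YoungAlgebra.add_apply, add_smul, Finset.sum_add_distrib]
  map_smul' c a := by
    simp only [YoungAlgebra.smul_apply, Finset.smul_sum, mul_smul, RingHom.id_apply]

/-- The standard extension of degree `n` of a Young diagram of degree `m ≤ n`: add `n - m` lines of
unit length. -/
def standardExtension {m n : ℕ} (h : m ≤ n) (Δ : m.Partition) : n.Partition where
  parts := Δ.parts + Multiset.replicate (n - m) 1
  parts_pos {i} hi := by
    rcases Multiset.mem_add.1 hi with hi | hi
    · exact Δ.parts_pos hi
    · rw [Multiset.eq_of_mem_replicate hi]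
      exact one_pos
  parts_sum := by
    rw [Multiset.sum_add, Δ.parts_sum, Multiset.sum_replicate, smul_eq_mul, mul_one]
    omega

/-- The linear map `ρ_n : A_m → A_n`, `m ≤ n`, which sends a Young diagram `Δ` with standard
extension `Δ'` to `|Aut Δ'| / (|Aut Δ| |Aut (Δ' \ Δ)|) Δ'`. -/
def rho {m n : ℕ} (h : m ≤ n) : YoungAlgebra m →ₗ[ℂ] YoungAlgebra n where
  toFun a := ∑ Δ : m.Partition,
    (a Δ * ((autCard (standardExtension h Δ).parts : ℂ) /
      (autCard Δ.parts * autCard (Multiset.replicate (n - m) 1)))) •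
        YoungAlgebra.diagram (standardExtension h Δ)
  map_add' a b := by
    simp only [YoungAlgebra.add_apply, add_mul, add_smul, Finset.sum_add_distrib]
  map_smul' c a := by
    simp only [YoungAlgebra.smul_apply, Finset.smul_sum, mul_assoc, mul_smul, RingHom.id_apply]

/-- The algebra `A^as` of sequences `(a¹, a², …)` with `aⁿ ∈ A_n`, `n ≥ 1`, with entrywise
operations. -/
abbrev AsymptoticAlgebra : Type := ∀ n : ℕ+, YoungAlgebra n

/-- The sequence `a^as` of an element `a ∈ A_m`: its entries are `0` below `m` and `ρ_i(a)` for
`i ≥ m`. -/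
def asymptoticSequence {m : ℕ} (a : YoungAlgebra m) : AsymptoticAlgebra :=
  fun i => if h : m ≤ i then rho h a else 0

end

/-!
Order `D_∞` by restriction: `(d, σ) ≤ (e, τ)` if `d ⊆ e` and `τ` extends `σ` by the identity. For
`s ∈ S_n` the sum of the coefficients of `f ∈ A_∞` over all restrictions of `s` is a class function
of `s`, that is, an element of `A_n`; since `u v` is a restriction of `s` exactly when `u` and `v`
are restrictions of some `x` and of `x⁻¹ s`, the product of `A_∞` becomes the convolution on `S_n`.
On `[Δ]` this sum counts the ways to remove `n - |Δ|` fixed points from `s`; this is a binomial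
coefficient, and it is the coefficient `|Aut Δ~| / (|Aut Δ| |Aut (Δ~ \ Δ)|)` in the definition of
`ρ_n`.

If all sums of `f` over the restrictions of elements with nonempty domain vanish, so do the sums of
`f(q) + f(q ∪ {x})` over the restrictions `q` of any element without `x` in its domain. By induction
every term vanishes: adding a fixed point changes the sign of the coefficient. As `f` has bounded
degree, adding enough fixed points gives `f = 0`.
-/

open scoped Finset

noncomputable section

theorem eq_zero_of_sum_Iic_eq_zero {α M : Type*} [PartialOrder α] [LocallyFiniteOrderBot α]
    [AddCommMonoid M] {g : α → M} {p : α} (h : ∀ q ≤ p, ∑ r ∈ Finset.Iic q, g r = 0) :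
    g p = 0 := by
  induction hc : (Finset.Iic p).card using Nat.strong_induction_on generalizing p with
  | _ n ih =>
    rw [← h p le_rfl]
    refine (Finset.sum_eq_single_of_mem p (Finset.mem_Iic.2 le_rfl) fun q hq hne => ?_).symm
    have hqp : q < p := (Finset.mem_Iic.1 hq).lt_of_ne hne
    refine ih _ ?_ (fun r hr => h r (hr.trans hqp.le)) rfl
    exact hc ▸ Finset.card_lt_card (Finset.Iic_ssubset_Iic.2 hqp)

theorem autCard_add_of_disjoint {s t : Multiset ℕ} (h : Disjoint s t) :
    autCard (s + t) = autCard s * autCard t := by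
  have hdisj : Disjoint s.toFinset t.toFinset := Multiset.disjoint_toFinset.2 h
  rw [autCard, Multiset.toFinset_add, Finset.prod_union hdisj, autCard, autCard]
  congr 1 <;> refine Finset.prod_congr rfl fun j hj => ?_
  · have : t.count j = 0 := Multiset.count_eq_zero.2
      (Multiset.disjoint_left.1 h (Multiset.mem_toFinset.1 hj))
    rw [Multiset.count_add, this, add_zero]
  · have : s.count j = 0 := Multiset.count_eq_zero.2
      (Multiset.disjoint_right.1 h (Multiset.mem_toFinset.1 hj))
    rw [Multiset.count_add, this, zero_add]

theorem autCard_replicate_one (k : ℕ) : autCard (Multiset.replicate k 1) = k ! := by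
  rcases eq_or_ne k 0 with rfl | hk
  · rfl
  · rw [autCard, Multiset.toFinset_replicate, if_neg hk, Finset.prod_singleton,
      Multiset.count_replicate_self, one_pow, mul_one]

theorem autCard_eq_filter_mul_factorial (s : Multiset ℕ) :
    autCard s = autCard (s.filter (· ≠ 1)) * (s.count 1)! := by
  have hdisj : Disjoint (s.filter (· ≠ 1)) (Multiset.replicate (s.count 1) 1) :=
    Multiset.disjoint_left.2 fun hj hj' =>
      (Multiset.mem_filter.1 hj).2 (Multiset.eq_of_mem_replicate hj')
  rw [← autCard_replicate_one, ← autCard_add_of_disjoint hdisj, ← Multiset.filter_eq',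
    add_comm, Multiset.filter_add_not]

theorem autCard_add_replicate_one (s : Multiset ℕ) (k : ℕ) :
    autCard (s + Multiset.replicate k 1) = (s.count 1 + k).choose k * (autCard s * k !) := by
  have hfilter : (s + Multiset.replicate k 1).filter (· ≠ 1) = s.filter (· ≠ 1) := by
    rw [Multiset.filter_add, add_eq_left, Multiset.filter_eq_nil]
    exact fun j hj hne => hne (Multiset.eq_of_mem_replicate hj)
  rw [autCard_eq_filter_mul_factorial (s + _), hfilter, Multiset.count_add,
    Multiset.count_replicate_self, autCard_eq_filter_mul_factorial s,
    ← Nat.add_choose_mul_factorial_mul_factorial]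
  ring

section Perm

open Equiv

variable {α β : Type*} [Fintype α] [DecidableEq α] [Fintype β] [DecidableEq β]

theorem cycleType_viaEmbedding (s : Perm α) (j : α ↪ β) :
    (s.viaEmbedding j).cycleType = s.cycleType := by
  rw [Perm.viaEmbedding]
  convert Perm.cycleType_extendDomain (Equiv.ofInjective j.1 j.2)

theorem parts_partition_viaEmbedding (s : Perm α) (j : α ↪ β) :
    (s.viaEmbedding j).partition.parts =
      s.partition.parts + Multiset.replicate (Fintype.card β - Fintype.card α) 1 := by
  have hsupport : s.support.card ≤ Fintype.card α := Finset.card_le_univ _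
  have hcard : Fintype.card α ≤ Fintype.card β := Fintype.card_le_of_embedding j
  rw [Perm.parts_partition, Perm.parts_partition, ← Perm.sum_cycleType,
    cycleType_viaEmbedding, Perm.sum_cycleType, add_assoc, ← Multiset.replicate_add]
  congr 2
  omega

theorem count_one_parts_partition (s : Perm α) :
    s.partition.parts.count 1 = #{x | s x = x} := by
  have hcycle : s.cycleType.count 1 = 0 :=
    Multiset.count_eq_zero.2 fun h => (Perm.two_le_of_mem_cycleType h).not_gt one_lt_two
  rw [Perm.parts_partition, Multiset.count_add, hcycle, Multiset.count_replicate_self, zero_add,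
    ← Finset.card_compl]
  congr 1
  ext x
  simp

end Perm

namespace PartialPerm

/-- The cycle type of an element of `D_∞` as a Young diagram. -/
def partition (p : PartialPerm) : p.dom.card.Partition where
  parts := p.type
  parts_pos hi := p.restrict.partition.parts_pos hi
  parts_sum := p.type_sum

open Finset Equiv

/-- The partial order of `D_∞` by restriction: `q ≤ p` if `q` arises from `p` by removing fixed
points from the domain. The condition that only fixed points are removed is contained in the
equality of the permutations, since these are extended by the identity. -/
instance : PartialOrder PartialPerm where
  le q p := q.dom ⊆ p.dom ∧ q.perm = p.perm
  le_refl _ := ⟨subset_rfl, rfl⟩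
  le_trans _ _ _ h₁ h₂ := ⟨h₁.1.trans h₂.1, h₁.2.trans h₂.2⟩
  le_antisymm _ _ h₁ h₂ := PartialPerm.ext (h₁.1.antisymm h₂.1) h₁.2

open Classical in
instance : LocallyFiniteOrderBot PartialPerm :=
  .ofIic _ (fun p => {q ∈ (finite_dom_subset p.dom).toFinset | q ≤ p}) fun p q => by
    simpa using fun h : q ≤ p => h.1

/-- Conjugation by a permutation of the natural numbers, as an automorphism of the order. -/
def conjOrderIso (g : Perm ℕ) : PartialPerm ≃o PartialPerm where
  toFun := conj g
  invFun := conj g⁻¹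
  left_inv p := by simpa using conj_conj_inv g⁻¹ p
  right_inv := conj_conj_inv g
  map_rel_iff' {p q} := and_congr map_subset_map (by simp [conj])

section ofPerm

variable {α : Type*} [Fintype α] (i : α ↪ ℕ)

/-- A permutation of a finite type, transported to the range of an embedding into the natural
numbers. -/
def ofPerm (s : Perm α) : PartialPerm where
  dom := univ.map i
  perm := Perm.viaEmbeddingHom i s
  perm_eq x hx := s.viaEmbedding_apply_of_notMem i x (by simpa using hx)

theorem le_ofPerm_iff {u : PartialPerm} {s : Perm α} :
    u ≤ ofPerm i s ↔ u.dom ⊆ univ.map i ∧ u.perm = Perm.viaEmbeddingHom i s := Iff.rfl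

theorem ofPerm_restrict (p : PartialPerm) :
    ofPerm (Function.Embedding.subtype (· ∈ p.dom)) p.restrict = p := by
  refine PartialPerm.ext (by ext; simp [ofPerm]) (Equiv.ext fun x => ?_)
  by_cases hx : x ∈ p.dom
  · exact p.restrict.viaEmbedding_apply (Function.Embedding.subtype (· ∈ p.dom)) ⟨x, hx⟩
  · rw [p.perm_eq x hx]
    exact p.restrict.viaEmbedding_apply_of_notMem _ x (by simpa using hx)

theorem type_eq_of_ofPerm_le [DecidableEq α] {s : Perm α} {p : PartialPerm}
    (h : ofPerm i s ≤ p) :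
    p.type = s.partition.parts + Multiset.replicate (p.dom.card - Fintype.card α) 1 := by
  let j : α ↪ p.dom := ⟨fun a => ⟨i a, h.1 (mem_map_of_mem i (mem_univ a))⟩, fun a b hab =>
    i.injective (congrArg Subtype.val hab)⟩
  have hrestrict : p.restrict = s.viaEmbedding j := by
    refine Equiv.ext fun x => Subtype.ext ?_
    change p.perm x = _
    rw [← h.2]
    by_cases hx : x ∈ Set.range j
    · obtain ⟨a, rfl⟩ := hx
      rw [Perm.viaEmbedding_apply]
      exact s.viaEmbedding_apply i a
    · rw [Perm.viaEmbedding_apply_of_notMem _ _ _ hx]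
      refine s.viaEmbedding_apply_of_notMem i x ?_
      rintro ⟨a, ha⟩
      exact hx ⟨a, Subtype.ext ha⟩
  rw [type, hrestrict, parts_partition_viaEmbedding, Fintype.card_coe]

theorem type_ofPerm [DecidableEq α] (s : Perm α) : (ofPerm i s).type = s.partition.parts := by
  simpa [ofPerm] using type_eq_of_ofPerm_le i (le_refl (ofPerm i s))

theorem type_ofPerm_valEmbedding {n : ℕ} (s : Perm (Fin n)) :
    (ofPerm Fin.valEmbedding s).type = (permType s).parts :=
  type_ofPerm _ s

theorem card_dom_ofPerm (s : Perm α) : (ofPerm i s).dom.card = Fintype.card α := card_map i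

theorem one_le_ofPerm_iff {s : Perm α} : 1 ≤ ofPerm i s ↔ s = 1 := by
  rw [le_ofPerm_iff, eq_comm (b := Perm.viaEmbeddingHom i s)]
  exact (and_iff_right (empty_subset _)).trans
    (map_eq_one_iff _ (Perm.viaEmbeddingHom_injective i))

theorem exists_le_ofPerm {u : PartialPerm} (h : u.dom ⊆ univ.map i) : ∃ s, u ≤ ofPerm i s := by
  have hrange : ∀ x, u.perm x ∈ Set.range i ↔ x ∈ Set.range i := by
    intro x
    by_cases hx : x ∈ u.dom
    · have hi : ∀ y ∈ u.dom, y ∈ Set.range i := fun y hy => by simpa using h hy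
      exact iff_of_true (hi _ ((u.perm_mem_iff x).2 hx)) (hi x hx)
    · rw [u.perm_eq x hx]
  refine ⟨(Equiv.ofInjective i i.injective).symm.permCongr (u.perm.subtypePerm hrange),
    h, Equiv.ext fun x => ?_⟩
  by_cases hx : x ∈ Set.range i
  · obtain ⟨a, rfl⟩ := hx
    refine .trans ?_ (Perm.viaEmbedding_apply _ i a).symm
    exact (Equiv.apply_ofInjective_symm i.injective ⟨u.perm (i a), _⟩).symm
  · refine .trans ?_ (Perm.viaEmbedding_apply_of_notMem _ i x hx).symm
    exact u.perm_eq x fun hu => hx (by simpa using h hu)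

theorem mul_le_ofPerm_iff {u v : PartialPerm} {s : Perm α} :
    u * v ≤ ofPerm i s ↔ ∃ x, u ≤ ofPerm i x ∧ v ≤ ofPerm i (x⁻¹ * s) := by
  constructor
  · rintro ⟨hdom : u.dom ∪ v.dom ⊆ _, hperm : u.perm * v.perm = Perm.viaEmbeddingHom i s⟩
    obtain ⟨x, hx⟩ := exists_le_ofPerm i (subset_union_left.trans hdom)
    refine ⟨x, hx, subset_union_right.trans hdom, ?_⟩
    have hux : u.perm = Perm.viaEmbeddingHom i x := hx.2
    change v.perm = Perm.viaEmbeddingHom i (x⁻¹ * s)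
    rw [map_mul, map_inv, ← hperm, ← hux, inv_mul_cancel_left]
  · rintro ⟨x, hu, hv⟩
    refine ⟨union_subset hu.1 hv.1, ?_⟩
    change u.perm * v.perm = Perm.viaEmbeddingHom i s
    rw [hu.2, hv.2]
    exact (map_mul (Perm.viaEmbeddingHom i) _ _).symm.trans (by rw [mul_inv_cancel_left])

end ofPerm

theorem type_eq_of_le {p q : PartialPerm} (h : q ≤ p) :
    p.type = q.type + Multiset.replicate (p.dom.card - q.dom.card) 1 := by
  rw [← ofPerm_restrict q] at h
  simpa only [type, Fintype.card_coe q.dom] using type_eq_of_ofPerm_le _ h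

theorem card_fixed_eq_count_type (p : PartialPerm) :
    #{x ∈ p.dom | p.perm x = x} = p.type.count 1 := by
  rw [type, count_one_parts_partition, card_filter, card_filter, ← sum_coe_sort p.dom]
  simp only [Subtype.ext_iff]
  rfl

theorem exists_le_dom_eq_sdiff {p : PartialPerm} {t : Finset ℕ} (ht : ∀ x ∈ t, p.perm x = x) :
    ∃ q ≤ p, q.dom = p.dom \ t := by
  refine ⟨⟨p.dom \ t, p.perm, fun x hx => ?_⟩, ⟨sdiff_subset, rfl⟩, rfl⟩
  by_cases hxp : x ∈ p.dom
  · exact ht x (by simpa [hxp] using hx)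
  · exact p.perm_eq x hxp

theorem card_filter_Iic_type_eq {p : PartialPerm} {M : Multiset ℕ} {k : ℕ}
    (h : p.type = M + Multiset.replicate k 1) :
    #{q ∈ Iic p | q.type = M} = (p.type.count 1).choose k := by
  have hcard : p.dom.card = M.sum + k := by
    rw [← type_sum, h, Multiset.sum_add, Multiset.sum_replicate, smul_eq_mul, mul_one]
  rw [← card_fixed_eq_count_type, ← card_powersetCard]
  refine card_bij (fun q _ => p.dom \ q.dom) ?_ ?_ ?_
  · intro q hq
    obtain ⟨hle, htype⟩ := mem_filter.1 hq
    obtain ⟨hdom, hperm⟩ := mem_Iic.1 hle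
    refine mem_powersetCard.2 ⟨fun x hx => ?_, ?_⟩
    · obtain ⟨hxp, hxq⟩ := mem_sdiff.1 hx
      exact mem_filter.2 ⟨hxp, by rw [← hperm, q.perm_eq x hxq]⟩
    · rw [card_sdiff_of_subset hdom, hcard, ← htype, type_sum, Nat.add_sub_cancel_left]
  · intro q hq r hr hqr
    obtain ⟨hqdom, hqperm⟩ := mem_Iic.1 (mem_filter.1 hq).1
    obtain ⟨hrdom, hrperm⟩ := mem_Iic.1 (mem_filter.1 hr).1
    refine PartialPerm.ext ?_ (hqperm.trans hrperm.symm)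
    rw [← Finset.sdiff_sdiff_eq_self hqdom, hqr, Finset.sdiff_sdiff_eq_self hrdom]
  · intro t ht
    obtain ⟨hfix, htcard⟩ := mem_powersetCard.1 ht
    have htdom : t ⊆ p.dom := hfix.trans (filter_subset _ _)
    obtain ⟨q, hq, hqdom⟩ := exists_le_dom_eq_sdiff fun x hx => (mem_filter.1 (hfix hx)).2
    have ht : p.dom \ q.dom = t := by rw [hqdom, Finset.sdiff_sdiff_eq_self htdom]
    have htype := type_eq_of_le hq
    rw [h, ← card_sdiff_of_subset hq.1, ht, htcard] at htype
    exact ⟨q, mem_filter.2 ⟨mem_Iic.2 hq, (add_right_cancel htype).symm⟩, ht⟩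

/-- The element of `D_∞` obtained by adding `x` to the domain (as a fixed point, if it is not yet
there). -/
def insertFixed (x : ℕ) (p : PartialPerm) : PartialPerm where
  dom := insert x p.dom
  perm := p.perm
  perm_eq y hy := p.perm_eq y fun h => hy (mem_insert_of_mem h)

theorem le_insertFixed_iff {x : ℕ} {p q : PartialPerm} (hx : x ∉ p.dom) :
    q ≤ insertFixed x p ↔ q ≤ p ∨ ∃ r ≤ p, insertFixed x r = q := by
  constructor
  · rintro ⟨hdom : q.dom ⊆ insert x p.dom, hperm : q.perm = p.perm⟩
    by_cases hxq : x ∈ q.dom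
    · refine .inr ⟨⟨q.dom.erase x, q.perm, fun y hy => ?_⟩, ⟨?_, hperm⟩,
        PartialPerm.ext (insert_erase hxq) rfl⟩
      · rcases eq_or_ne y x with rfl | hne
        · rw [hperm, p.perm_eq y hx]
        · exact q.perm_eq y fun h => hy (mem_erase.2 ⟨hne, h⟩)
      · exact subset_insert_iff.1 hdom
    · exact .inl ⟨(subset_insert_iff_of_notMem hxq).1 hdom, hperm⟩
  · rintro (h | ⟨r, h, rfl⟩)
    · exact ⟨h.1.trans (subset_insert _ _), h.2⟩
    · exact ⟨insert_subset_insert _ h.1, h.2⟩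

theorem sum_Iic_insertFixed {M : Type*} [AddCommMonoid M] (f : PartialPerm → M) {x : ℕ}
    {p : PartialPerm} (hx : x ∉ p.dom) :
    ∑ q ∈ Iic (insertFixed x p), f q = ∑ q ∈ Iic p, (f q + f (insertFixed x q)) := by
  classical
  have hnotMem : ∀ q ∈ Iic p, x ∉ q.dom := fun q hq h => hx ((mem_Iic.1 hq).1 h)
  have hunion : Iic (insertFixed x p) = Iic p ∪ (Iic p).image (insertFixed x) := by
    ext q
    simp only [mem_Iic, mem_union, mem_image, le_insertFixed_iff hx]
  have hdisj : Disjoint (Iic p) ((Iic p).image (insertFixed x)) := by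
    refine disjoint_left.2 fun q hq hq' => hnotMem q hq ?_
    obtain ⟨r, -, rfl⟩ := mem_image.1 hq'
    exact mem_insert_self _ _
  rw [hunion, sum_union hdisj, sum_add_distrib, sum_image]
  intro q hq r hr hqr
  refine PartialPerm.ext ?_ (congrArg perm hqr :)
  rw [← erase_insert (hnotMem q hq), ← erase_insert (hnotMem r hr)]
  exact congrArg (·.dom.erase x) hqr

end PartialPerm

namespace FormalSum

open Finset PartialPerm

/-- The sum of the coefficients of all restrictions of `p`, as a linear form on formal sums. -/
def restrictionSum (p : PartialPerm) : FormalSum →ₗ[ℂ] ℂ where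
  toFun f := ∑ q ∈ Iic p, f q
  map_add' _ _ := sum_add_distrib
  map_smul' _ _ := (mul_sum _ _ _).symm

theorem restrictionSum_apply (p : PartialPerm) (f : FormalSum) :
    restrictionSum p f = ∑ q ∈ Iic p, f q := rfl

section ofPerm

variable {α : Type*} [Fintype α] [DecidableEq α] (i : α ↪ ℕ)

theorem restrictionSum_ofPerm_one (s : Equiv.Perm α) :
    restrictionSum (ofPerm i s) 1 = if s = 1 then 1 else 0 := by
  classical
  simp only [restrictionSum_apply, one_apply, sum_ite_eq', mem_Iic, one_le_ofPerm_iff]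

theorem restrictionSum_ofPerm_mul (s : Equiv.Perm α) (f g : FormalSum) :
    restrictionSum (ofPerm i s) (f * g) =
      ∑ x, restrictionSum (ofPerm i x) f * restrictionSum (ofPerm i (x⁻¹ * s)) g := by
  classical
  let pairs (x : Equiv.Perm α) := Iic (ofPerm i x) ×ˢ Iic (ofPerm i (x⁻¹ * s))
  have hbiUnion : (Iic (ofPerm i s)).biUnion factorizations = univ.biUnion pairs := by
    ext ⟨u, v⟩
    simp [pairs, mem_factorizations, mul_le_ofPerm_iff]
  have hfactorizations : (Iic (ofPerm i s) : Set PartialPerm).PairwiseDisjoint factorizations :=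
    fun p _ q _ hpq => disjoint_left.2 fun w hp hq =>
      hpq ((mem_factorizations.1 hp).symm.trans (mem_factorizations.1 hq))
  have hpairs : ((univ : Finset (Equiv.Perm α)) : Set _).PairwiseDisjoint pairs := by
    refine fun x _ y _ hxy => disjoint_left.2 fun w hx hy => hxy ?_
    have hwx : w.1 ≤ ofPerm i x := mem_Iic.1 (mem_product.1 hx).1
    have hwy : w.1 ≤ ofPerm i y := mem_Iic.1 (mem_product.1 hy).1
    exact Equiv.Perm.viaEmbeddingHom_injective i (hwx.2.symm.trans hwy.2)
  calc restrictionSum (ofPerm i s) (f * g)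
      = ∑ w ∈ (Iic (ofPerm i s)).biUnion factorizations, f w.1 * g w.2 :=
        (sum_biUnion hfactorizations).symm
    _ = ∑ x, ∑ w ∈ pairs x, f w.1 * g w.2 := by rw [hbiUnion, sum_biUnion hpairs]
    _ = ∑ x, restrictionSum (ofPerm i x) f * restrictionSum (ofPerm i (x⁻¹ * s)) g :=
        sum_congr rfl fun x _ => (sum_product _ _ _).trans (sum_mul_sum _ _ _ _).symm

end ofPerm

theorem restrictionSum_eq_of_type_eq {f : FormalSum} (hf : f ∈ classSpan) {p q : PartialPerm}
    (h : p.type = q.type) : restrictionSum p f = restrictionSum q f := by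
  obtain ⟨g, rfl⟩ := exists_conj h
  refine sum_equiv (conjOrderIso g).toEquiv (fun r => ?_) fun r _ => ?_
  · rw [mem_Iic, mem_Iic]
    exact ((conjOrderIso g).le_iff_le).symm
  · exact ((mem_classSpan_iff f).1 hf).2 _ _ (type_conj g r).symm

theorem restrictionSum_classSum (p : PartialPerm) {m : ℕ} (Δ : m.Partition) :
    restrictionSum p (classSum Δ) =
      if p.type = Δ.parts + Multiset.replicate (p.dom.card - m) 1 then
        ((p.type.count 1).choose (p.dom.card - m) : ℂ) else 0 := by
  split_ifs with h
  · rw [← card_filter_Iic_type_eq h, ← sum_boole]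
    rfl
  · refine sum_eq_zero fun q hq => if_neg fun hqΔ => h ?_
    rw [type_eq_of_le (mem_Iic.1 hq), ← q.type_sum, hqΔ, Δ.parts_sum]

theorem apply_add_apply_insertFixed_eq_zero {f : FormalSum}
    (hsum : ∀ p : PartialPerm, p.dom.Nonempty → restrictionSum p f = 0) {p : PartialPerm} {x : ℕ}
    (hx : x ∉ p.dom) : f p + f (insertFixed x p) = 0 := by
  refine eq_zero_of_sum_Iic_eq_zero (g := fun q => f q + f (insertFixed x q)) fun q hq => ?_
  rw [← sum_Iic_insertFixed f fun h => hx (hq.1 h)]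
  exact hsum _ (insert_nonempty x q.dom)

theorem eq_zero_of_restrictionSum_eq_zero {f : FormalSum} {N : ℕ}
    (hN : ∀ p : PartialPerm, N < p.dom.card → f p = 0)
    (hsum : ∀ p : PartialPerm, p.dom.Nonempty → restrictionSum p f = 0) : f = 0 := by
  suffices h : ∀ k (p : PartialPerm), N < p.dom.card + k → f p = 0 from
    funext fun p => h (N + 1) p (by omega)
  intro k
  induction k with
  | zero => exact hN
  | succ k ih =>
    intro p hp
    obtain ⟨x, hx⟩ := Infinite.exists_notMem_finset p.dom
    have hcard : (insertFixed x p).dom.card = p.dom.card + 1 := card_insert_of_notMem hx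
    have hinsert : f (insertFixed x p) = 0 := ih _ (by omega)
    simpa only [hinsert, add_zero] using apply_add_apply_insertFixed_eq_zero hsum hx

end FormalSum

theorem YoungAlgebra.sum_apply {ι : Type*} {n : ℕ} (t : Finset ι) (a : ι → YoungAlgebra n)
    (q : n.Partition) : (∑ i ∈ t, a i) q = ∑ i ∈ t, a i q :=
  Finset.sum_apply (M := fun _ => ℂ) q t a

theorem autCard_standardExtension_div {m n : ℕ} (h : m ≤ n) (Δ : m.Partition) :
    (autCard (standardExtension h Δ).parts : ℂ) /
        (autCard Δ.parts * autCard (Multiset.replicate (n - m) 1)) =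
      ((standardExtension h Δ).parts.count 1).choose (n - m) := by
  have hfactorial : ((n - m)! : ℂ) ≠ 0 := Nat.cast_ne_zero.2 (Nat.factorial_ne_zero _)
  rw [autCard_replicate_one, div_eq_iff (mul_ne_zero (YoungAlgebra.autCard_ne_zero Δ) hfactorial),
    standardExtension, autCard_add_replicate_one, Multiset.count_add,
    Multiset.count_replicate_self]
  push_cast
  rfl

theorem rho_apply {m n : ℕ} (h : m ≤ n) (a : YoungAlgebra m) (q : n.Partition) :
    rho h a q = ∑ Δ : m.Partition, a Δ *
      if q = standardExtension h Δ then ((q.parts.count 1).choose (n - m) : ℂ) else 0 := by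
  rw [rho, LinearMap.coe_mk, AddHom.coe_mk, YoungAlgebra.sum_apply]
  refine Finset.sum_congr rfl fun Δ _ => ?_
  rw [autCard_standardExtension_div, YoungAlgebra.smul_apply, YoungAlgebra.diagram]
  split_ifs with hq
  · rw [hq, mul_one]
  · rw [mul_zero, mul_zero]

namespace IvanovKerovAlgebra

open FormalSum PartialPerm

theorem coe_toIvanovKerov (m : ℕ) (a : YoungAlgebra m) :
    (toIvanovKerov m a : FormalSum) = ∑ Δ : m.Partition, a Δ • classSum Δ :=
  AddSubmonoidClass.coe_finsetSum _ _

theorem coe_toIvanovKerov_diagram {m : ℕ} (Δ : m.Partition) :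
    (toIvanovKerov m (YoungAlgebra.diagram Δ) : FormalSum) = classSum Δ := by
  simp [coe_toIvanovKerov, YoungAlgebra.diagram]

theorem linearMap_ext {M : Type*} [AddCommMonoid M] [Module ℂ M]
    {u v : IvanovKerovAlgebra →ₗ[ℂ] M}
    (h : ∀ (m : ℕ) (a : YoungAlgebra m), u (toIvanovKerov m a) = v (toIvanovKerov m a)) :
    u = v := by
  have hspan : classSpan ≤ (LinearMap.eqLocus u v).map IvanovKerovAlgebra.val.toLinearMap := by
    refine Submodule.span_le.2 ?_
    rintro _ ⟨⟨m, Δ⟩, rfl⟩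
    exact ⟨toIvanovKerov m (YoungAlgebra.diagram Δ), h _ _, coe_toIvanovKerov_diagram Δ⟩
  refine LinearMap.ext fun f => ?_
  obtain ⟨f', hf', hval⟩ := hspan f.2
  exact Subtype.ext hval ▸ hf'

/-- The component `A_∞ → A_n` of `ρ_↑`: the class function on `S_n` whose value at `s` is the sum of
the coefficients of all restrictions of `s`. The representative `s` of the cycle type `q` chosen
here does not matter, see `toYoungAlgebra_permType`. -/
def toYoungAlgebra (n : ℕ) : IvanovKerovAlgebra →ₗ[ℂ] YoungAlgebra n where
  toFun f q :=
    restrictionSum (ofPerm Fin.valEmbedding (Function.surjInv (permType_surjective n) q)) f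
  map_add' _ _ := YoungAlgebra.ext fun _ => map_add (restrictionSum _) _ _
  map_smul' _ _ := YoungAlgebra.ext fun _ => map_smul (restrictionSum _) _ _

theorem toYoungAlgebra_permType {n : ℕ} (f : IvanovKerovAlgebra) (s : Equiv.Perm (Fin n)) :
    toYoungAlgebra n f (permType s) = restrictionSum (ofPerm Fin.valEmbedding s) f := by
  refine restrictionSum_eq_of_type_eq f.2 ?_
  rw [type_ofPerm_valEmbedding, type_ofPerm_valEmbedding,
    Function.surjInv_eq (permType_surjective n)]

theorem toYoungAlgebra_one (n : ℕ) : toYoungAlgebra n 1 = 1 :=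
  YoungAlgebra.ext_permType fun s => by
    rw [toYoungAlgebra_permType, YoungAlgebra.one_permType]
    exact restrictionSum_ofPerm_one _ s

theorem toYoungAlgebra_mul (n : ℕ) (f g : IvanovKerovAlgebra) :
    toYoungAlgebra n (f * g) = toYoungAlgebra n f * toYoungAlgebra n g :=
  YoungAlgebra.ext_permType fun s => by
    simp only [YoungAlgebra.mul_permType, toYoungAlgebra_permType]
    exact restrictionSum_ofPerm_mul _ s f g

theorem toYoungAlgebra_toIvanovKerov {m : ℕ} (a : YoungAlgebra m) (n : ℕ+) :
    toYoungAlgebra n (toIvanovKerov m a) = asymptoticSequence a n := by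
  refine YoungAlgebra.ext_permType fun s => ?_
  rw [toYoungAlgebra_permType, coe_toIvanovKerov, map_sum, asymptoticSequence]
  simp only [map_smul, smul_eq_mul, restrictionSum_classSum, type_ofPerm_valEmbedding,
    card_dom_ofPerm, Fintype.card_fin]
  split_ifs with h
  · simp only [rho_apply, Nat.Partition.ext_iff, standardExtension]
  · refine Finset.sum_eq_zero fun Δ _ => ?_
    rw [if_neg, mul_zero]
    intro hparts
    have hsum := congrArg Multiset.sum hparts
    rw [Multiset.sum_add, (permType s).parts_sum, Δ.parts_sum] at hsum
    omega

theorem restrictionSum_eq_toYoungAlgebra (f : IvanovKerovAlgebra) (p : PartialPerm) :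
    restrictionSum p f = toYoungAlgebra p.dom.card f p.partition := by
  obtain ⟨s, hs⟩ := permType_surjective _ p.partition
  rw [← hs, toYoungAlgebra_permType]
  refine restrictionSum_eq_of_type_eq f.2 ?_
  rw [type_ofPerm_valEmbedding, hs, partition]

/-- The homomorphism `ρ_↑` from the Ivanov–Kerov algebra to the algebra of sequences. -/
def asymptoticHom : IvanovKerovAlgebra →ₐ[ℂ] AsymptoticAlgebra :=
  AlgHom.ofLinearMap (LinearMap.pi fun n : ℕ+ => toYoungAlgebra n)
    (funext fun n => toYoungAlgebra_one n) (fun f g => funext fun n => toYoungAlgebra_mul n f g)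

theorem asymptoticHom_toIvanovKerov (m : ℕ) (a : YoungAlgebra m) :
    asymptoticHom (toIvanovKerov m a) = asymptoticSequence a :=
  funext fun n => toYoungAlgebra_toIvanovKerov a n

theorem asymptoticHom_injective : Function.Injective asymptoticHom := by
  rw [injective_iff_map_eq_zero]
  intro f hf
  obtain ⟨N, hN⟩ := ((mem_classSpan_iff f).1 f.2).1
  refine Subtype.ext (eq_zero_of_restrictionSum_eq_zero hN fun p hp => ?_)
  have hzero : toYoungAlgebra p.dom.card f = 0 := congrFun hf ⟨p.dom.card, hp.card_pos⟩
  rw [restrictionSum_eq_toYoungAlgebra, hzero, YoungAlgebra.zero_apply]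

end IvanovKerovAlgebra

end

/-- The correspondence `a ↦ a^as`, `a ∈ A_m`, extends (uniquely) from the Young diagrams to an
injective algebra homomorphism `ρ_↑` from the Ivanov–Kerov algebra to the algebra `A^as`. -/
theorem theorem3p1 :
    ∃ ρ : IvanovKerovAlgebra →ₐ[ℂ] AsymptoticAlgebra,
      (∀ (m : ℕ) (a : YoungAlgebra m), ρ (toIvanovKerov m a) = asymptoticSequence a) ∧
      Function.Injective ρ ∧
      ∀ ρ' : IvanovKerovAlgebra →ₗ[ℂ] AsymptoticAlgebra,
        (∀ (m : ℕ) (a : YoungAlgebra m), ρ' (toIvanovKerov m a) = asymptoticSequence a) →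
          ρ' = ρ.toLinearMap :=
  ⟨IvanovKerovAlgebra.asymptoticHom, IvanovKerovAlgebra.asymptoticHom_toIvanovKerov,
    IvanovKerovAlgebra.asymptoticHom_injective, fun _ h => IvanovKerovAlgebra.linearMap_ext
      fun m a => (h m a).trans (IvanovKerovAlgebra.asymptoticHom_toIvanovKerov m a).symm⟩
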